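/- There is a universal constant $C>0$ such that the following holds for every number $n$ of items and every $\varepsilon>0$. A \emph{valuation} is a function $v:2^{[n]}\to\mathbb R_{\ge 0}$; it is \emph{unit-demand} if $v(S)=\max_{i\in S}v(\{i\})$ for every $S\subseteq[n]$ (with $v(\emptyset)=0$). A \emph{lottery} (menu entry) is a pair of a probability distribution over subsets of $[n]$ and a price $p\ge 0$. In the \emph{buy-many mechanism generated by} a set $\Lambda$ of lotteries, the buyer may adaptively (and possibly at random) purchase a finite or infinite sequence of lotteries from $\Lambda$, choosing each purchase after seeing the sets allocated by the earlier ones; the buyer receives the union of all allocated sets and pays the sum of the prices, and a buyer of type $v$ uses a strategy that maximizes the expected value of the union minus the expected total payment. For a probability distribution $\mathcal D$ over valuations, $\mathrm{Rev}_{\mathcal D}$ of the mechanism is the expected payment of a buyer of type $v\sim\mathcal D$, and $\mathrm{BuyManyRev}(\mathcal D)$ is the supremum of $\mathrm{Rev}_{\mathcal D}$ over the buy-many mechanisms generated by arbitrary (possibly infinite) sets of lotteries, with ties among optimal strategies broken in the seller's favour; a type that has no optimal strategy counts as paying $0$. Let $\mathcal D$ be any probability distribution over unit-demand valuations on $n$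 items with $\mathrm{BuyManyRev}(\mathcal D)<\infty$. Then there is a buy-many mechanism $\mathcal M$, generated by at most $C\,(16n)^{6n}\varepsilon^{-12n}$ lotteries, such that $$\mathrm{Rev}_{\mathcal D}(\mathcal M)\ \ge\ (1-\varepsilon)\,\mathrm{BuyManyRev}(\mathcal D),$$ no matter how the buyer breaks ties among optimal strategies in $\mathcal M$. -/

import Mathlib

open MeasureTheory
open scoped NNReal ENNReal

namespace BuyMany

/-- A valuation over the items `0, …, n - 1`: a nonnegative value for every set of items. -/
abbrev ValuationFn (n : ℕ) : Type := Finset (Fin n) → ℝ≥0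

/-- Unit-demand: the value of a set is the value of the best item in it
(`Finset.sup` is a maximum in `ℝ≥0`, and is `0` over the empty set). -/
def IsUnitDemand {n : ℕ} (v : ValuationFn n) : Prop :=
  ∀ S : Finset (Fin n), v S = S.sup fun i => v {i}

/-- A lottery (menu entry): a random set of items and a price. -/
structure Lottery (n : ℕ) where
  /-- the randomized allocation -/
  alloc : PMF (Finset (Fin n))
  /-- the price charged -/
  price : ℝ≥0

/-- What the buyer has seen so far: the lotteries bought and the set each one of them allocated,
most recent purchase first. -/
abbrev History (n : ℕ) : Type := List (Lottery n × Finset (Fin n))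

/-- All items received along a history. -/
def received {n : ℕ} (h : History n) : Finset (Fin n) :=
  (h.map fun e => e.2).foldr (fun S T => S ∪ T) ∅

/-- The sum of the prices paid along a history. -/
noncomputable def paid {n : ℕ} (h : History n) : ℝ≥0 :=
  (h.map fun e => e.1.price).sum

/-- An adaptive purchasing strategy: after each history, the (possibly randomized) choice to stop
for good (`none`) or to buy some lottery next. -/
abbrev Strategy (n : ℕ) : Type := History n → PMF (Option (Lottery n))

namespace Strategy

variable {n : ℕ}

/-- The strategy buys only lotteries from `L`. -/
def BuysFrom (A : Strategy n) (L : Set (Lottery n)) : Prop :=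
  ∀ (h : History n) (l : Lottery n), some l ∈ (A h).support → l ∈ L

/-- One round. The flag in the state records whether the buyer has stopped. -/
noncomputable def step (A : Strategy n) : History n × Bool → PMF (History n × Bool)
  | (h, true) => PMF.pure (h, true)
  | (h, false) => (A h).bind fun o =>
      match o with
      | none => PMF.pure (h, true)
      | some l => l.alloc.map fun S => ((l, S) :: h, false)

/-- The law of the state after `k` rounds. -/
noncomputable def run (A : Strategy n) : ℕ → PMF (History n × Bool)
  | 0 => PMF.pure ([], false)
  | k + 1 => (A.run k).bind A.step

/-- The expected value of the union of all sets received. Strategies need not end after a bounded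
number of rounds; for monotone `v` the supremum is the limit over the number of rounds. -/
noncomputable def value (A : Strategy n) (v : ValuationFn n) : ℝ≥0∞ :=
  ⨆ k : ℕ, ∑' s : History n × Bool, A.run k s * (v (received s.1) : ℝ≥0∞)

/-- The expected total payment (possibly infinite). -/
noncomputable def payment (A : Strategy n) : ℝ≥0∞ :=
  ⨆ k : ℕ, ∑' s : History n × Bool, A.run k s * (paid s.1 : ℝ≥0∞)

/-- The expected utility. The value is always finite; the utility is `⊥` if the expected
payment is infinite. -/
noncomputable def utility (A : Strategy n) (v : ValuationFn n) : EReal :=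
  (A.value v : EReal) - (A.payment : EReal)

/-- `A` is a best response of a buyer with valuation `v` to the buy-many mechanism
generated by `L`. -/
def IsOptimal (A : Strategy n) (L : Set (Lottery n)) (v : ValuationFn n) : Prop :=
  A.BuysFrom L ∧ ∀ B : Strategy n, B.BuysFrom L → B.utility v ≤ A.utility v

end Strategy

/-- The payment of type `v` in the buy-many mechanism generated by `L`, ties among best responses
being broken in favour of the seller (`0` if there is no best response). -/
noncomputable def maxPayment {n : ℕ} (L : Set (Lottery n)) (v : ValuationFn n) : ℝ≥0∞ :=
  ⨆ (A : Strategy n) (_ : A.IsOptimal L v), A.payment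

open Classical in
/-- The payment of type `v` in the buy-many mechanism generated by `L`, ties among best responses
being broken against the seller (`0` if there is no best response). -/
noncomputable def minPayment {n : ℕ} (L : Set (Lottery n)) (v : ValuationFn n) : ℝ≥0∞ :=
  if ∃ A : Strategy n, A.IsOptimal L v then
    ⨅ (A : Strategy n) (_ : A.IsOptimal L v), A.payment
  else 0

/-- Expected revenue of the buy-many mechanism generated by `L` when the buyer's type is drawn
from `D` and ties are broken in favour of the seller. -/
noncomputable def maxRev {n : ℕ} (D : Measure (ValuationFn n)) (L : Set (Lottery n)) : ℝ≥0∞ :=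
  ∫⁻ v, maxPayment L v ∂D

/-- Expected revenue of the buy-many mechanism generated by `L` when the buyer's type is drawn
from `D` and ties are broken against the seller. -/
noncomputable def minRev {n : ℕ} (D : Measure (ValuationFn n)) (L : Set (Lottery n)) : ℝ≥0∞ :=
  ∫⁻ v, minPayment L v ∂D

/-- The optimal buy-many revenue: the supremum over the buy-many mechanisms generated by arbitrary,
possibly infinite, sets of lotteries. -/
noncomputable def buyManyRev {n : ℕ} (D : Measure (ValuationFn n)) : ℝ≥0∞ :=
  ⨆ L : Set (Lottery n), maxRev D L

end BuyMany

namespace BuyMany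

/-! For a unit-demand type `v`, a number `U ≥ 0` bounds the utility from a menu exactly when every
lottery on it has expected excess `E (v T - U)⁺` at most its price. Necessity: test the strategy
that repeats one lottery until it allocates a set worth more than `U` (`excess_le_price`).
Sufficiency: the excess of a union is at most the sum of the excesses, so prices pay for it round by
round (`expect_run_excess_le`). On a finite menu this also gives an optimal strategy.

A menu `L` thus enters only through linear inequalities on the vectors of single-item excesses. A
strategy with payment `p > 0` induces item weights `x` for which `p⁻¹ * x` lies in the polar of all
excess vectors of `L`. Rounding this polar to a grid leaves finitely many inequalities that imply
the rest up to a factor `1 + n / N` (`exists_finite_net`), and each is realised by a single-item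
lottery.

These lotteries are sold at a discount `a < 1`. Let a type have utility `U` and payment `p` in `L`,
and `V` and `pB` in the new menu. The net gives `U + p ≤ V + a(1 + n/N)p`; raising prices back by
`a⁻¹` gives `V + pB ≤ U + a⁻¹pB`. Eliminating `V - U` yields `a²p ≤ pB` for every pair of optimal
strategies, so tie-breaking is irrelevant. -/

/-- The expectation of a nonnegative function under a discrete law. -/
noncomputable def expect {α : Type*} (p : PMF α) (f : α → ℝ≥0∞) : ℝ≥0∞ := ∑' a, p a * f a

/-! ### Expectations under discrete laws -/

section Expect
variable {α β : Type*}

theorem expect_pure (a : α) (f : α → ℝ≥0∞) : expect (PMF.pure a) f = f a := by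
  classical
  unfold expect
  rw [tsum_eq_single a]
  · simp
  · intro b hb
    simp [PMF.pure_apply, hb]

theorem expect_bind (p : PMF α) (k : α → PMF β) (f : β → ℝ≥0∞) :
    expect (p.bind k) f = expect p fun a => expect (k a) f := by
  unfold expect
  simp only [PMF.bind_apply, ← ENNReal.tsum_mul_right, ← ENNReal.tsum_mul_left]
  rw [ENNReal.tsum_comm]
  simp only [mul_assoc]

theorem expect_map (p : PMF α) (k : α → β) (f : β → ℝ≥0∞) :
    expect (p.map k) f = expect p fun a => f (k a) := by
  rw [PMF.map, expect_bind]
  simp only [Function.comp, expect_pure]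

theorem expect_mono_of_support (p : PMF α) {f g : α → ℝ≥0∞} (h : ∀ a ∈ p.support, f a ≤ g a) :
    expect p f ≤ expect p g := by
  refine ENNReal.tsum_le_tsum fun a => ?_
  by_cases ha : p a = 0
  · simp [ha]
  · exact mul_le_mul_right (h a ((p.mem_support_iff a).2 ha)) _

theorem expect_mono (p : PMF α) {f g : α → ℝ≥0∞} (h : ∀ a, f a ≤ g a) :
    expect p f ≤ expect p g :=
  expect_mono_of_support p fun a _ => h a

theorem expect_add (p : PMF α) (f g : α → ℝ≥0∞) :
    expect p (fun a => f a + g a) = expect p f + expect p g := by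
  simp only [expect, mul_add, ENNReal.tsum_add]

theorem expect_const_mul (p : PMF α) (c : ℝ≥0∞) (f : α → ℝ≥0∞) :
    expect p (fun a => c * f a) = c * expect p f := by
  simp only [expect, ← ENNReal.tsum_mul_left]
  exact tsum_congr fun a => by ring

theorem expect_const (p : PMF α) (c : ℝ≥0∞) : expect p (fun _ => c) = c := by
  simp only [expect, ENNReal.tsum_mul_right, p.tsum_coe, one_mul]

theorem expect_finset_sum {ι : Type*} (p : PMF α) (s : Finset ι) (f : ι → α → ℝ≥0∞) :
    expect p (fun a => ∑ i ∈ s, f i a) = ∑ i ∈ s, expect p (f i) := by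
  classical
  induction s using Finset.induction_on with
  | empty => simp [expect]
  | insert i s hi ih => simp only [Finset.sum_insert hi, expect_add, ih]

end Expect

/-! ### Unit-demand valuations -/

section UnitDemand
variable {n : ℕ} {v : ValuationFn n}

theorem IsUnitDemand.empty (hv : IsUnitDemand v) : v ∅ = 0 := by
  rw [hv ∅]; simp

theorem IsUnitDemand.mono (hv : IsUnitDemand v) {S T : Finset (Fin n)} (h : S ⊆ T) :
    v S ≤ v T := by
  rw [hv S, hv T]; exact Finset.sup_mono h

theorem IsUnitDemand.union (hv : IsUnitDemand v) (S T : Finset (Fin n)) :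
    v (S ∪ T) = max (v S) (v T) := by
  rw [hv (S ∪ T), hv S, hv T, Finset.sup_union]

theorem IsUnitDemand.union_tsub_le (hv : IsUnitDemand v) (U : ℝ≥0) (S T : Finset (Fin n)) :
    v (S ∪ T) - U ≤ (v S - U) + (v T - U) := by
  rw [hv.union]
  rcases max_choice (v S) (v T) with h | h <;> rw [h]
  · exact le_self_add
  · exact le_add_self

theorem IsUnitDemand.exists_mem_eq (hv : IsUnitDemand v) {S : Finset (Fin n)}
    (hS : S.Nonempty) : ∃ i ∈ S, v S = v {i} := by
  obtain ⟨i, hi, h⟩ := Finset.exists_mem_eq_sup S hS fun i => v {i}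
  exact ⟨i, hi, by rw [hv S, h]⟩

end UnitDemand

@[simp] theorem received_nil {n : ℕ} : received ([] : History n) = ∅ := rfl
@[simp] theorem received_cons {n : ℕ} (e : Lottery n × Finset (Fin n)) (h : History n) :
    received (e :: h) = e.2 ∪ received h := rfl
@[simp] theorem paid_nil {n : ℕ} : paid ([] : History n) = 0 := rfl
@[simp] theorem paid_cons {n : ℕ} (e : Lottery n × Finset (Fin n)) (h : History n) :
    paid (e :: h) = e.1.price + paid h := by
  simp [paid]

/-! ### Strategies: excess bounds and utilities -/

namespace Strategy
variable {n : ℕ}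

theorem expect_run_zero (A : Strategy n) (f : History n × Bool → ℝ≥0∞) :
    expect (A.run 0) f = f ([], false) := expect_pure _ _

theorem expect_run_succ (A : Strategy n) (k : ℕ) (f : History n × Bool → ℝ≥0∞) :
    expect (A.run (k + 1)) f = expect (A.run k) fun s => expect (A.step s) f :=
  expect_bind _ _ _

theorem expect_step_true (A : Strategy n) (h : History n) (f : History n × Bool → ℝ≥0∞) :
    expect (A.step (h, true)) f = f (h, true) := expect_pure _ _

/-- The expectation of `f` after the choice `o` has been made at history `h`. -/
noncomputable def afterChoice (f : History n × Bool → ℝ≥0∞) (h : History n) :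
    Option (Lottery n) → ℝ≥0∞
  | none => f (h, true)
  | some l => expect l.alloc fun S => f ((l, S) :: h, false)

theorem expect_step_false (A : Strategy n) (h : History n) (f : History n × Bool → ℝ≥0∞) :
    expect (A.step (h, false)) f = expect (A h) (afterChoice f h) := by
  rw [show A.step (h, false) = (A h).bind fun o =>
      match o with
      | none => PMF.pure (h, true)
      | some l => l.alloc.map fun S => ((l, S) :: h, false) from rfl, expect_bind]
  congr 1
  funext o
  cases o with
  | none => exact expect_pure _ _
  | some l => exact expect_map _ _ _

theorem value_eq (A : Strategy n) (v : ValuationFn n) :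
    A.value v = ⨆ k, expect (A.run k) fun s => (v (received s.1) : ℝ≥0∞) := rfl

theorem payment_eq (A : Strategy n) :
    A.payment = ⨆ k, expect (A.run k) fun s => (paid s.1 : ℝ≥0∞) := rfl

/-- The price of a choice. -/
noncomputable def choicePrice : Option (Lottery n) → ℝ≥0∞
  | none => 0
  | some l => l.price

/-- The expected price of the next purchase. -/
noncomputable def nextPrice (A : Strategy n) : History n × Bool → ℝ≥0∞
  | (_, true) => 0
  | (h, false) => expect (A h) choicePrice

theorem expect_step_paid (A : Strategy n) (s : History n × Bool) :
    expect (A.step s) (fun s => (paid s.1 : ℝ≥0∞)) = paid s.1 + A.nextPrice s := by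
  obtain ⟨h, b⟩ := s
  cases b with
  | true => simp [expect_step_true, nextPrice]
  | false =>
    rw [expect_step_false]
    have : afterChoice (fun s : History n × Bool => (paid s.1 : ℝ≥0∞)) h
        = fun o => (paid h : ℝ≥0∞) + choicePrice o := by
      funext o
      cases o with
      | none => simp [afterChoice, choicePrice]
      | some l => simp [afterChoice, choicePrice, expect_const, add_comm]
    rw [this, expect_add, expect_const]
    rfl

/-- If no lottery yields an expected excess over `U` of more than `c` times its price,
then no strategy does. -/
theorem expect_run_excess_le {L : Set (Lottery n)} {v : ValuationFn n} (hv : IsUnitDemand v)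
    {U : ℝ≥0} {c : ℝ≥0∞}
    (hL : ∀ l ∈ L, expect l.alloc (fun T => ((v T - U : ℝ≥0) : ℝ≥0∞)) ≤ c * l.price)
    {A : Strategy n} (hA : A.BuysFrom L) (k : ℕ) :
    expect (A.run k) (fun s => ((v (received s.1) - U : ℝ≥0) : ℝ≥0∞))
      ≤ c * expect (A.run k) fun s => (paid s.1 : ℝ≥0∞) := by
  induction k with
  | zero => simp [expect_run_zero, hv.empty]
  | succ k ih =>
    -- One round raises the excess by at most the excess of the newly allocated set, whose
    -- expectation is charged to the price of that round.
    have key : ∀ s, expect (A.step s) (fun s => ((v (received s.1) - U : ℝ≥0) : ℝ≥0∞))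
        ≤ ((v (received s.1) - U : ℝ≥0) : ℝ≥0∞) + c * A.nextPrice s := by
      rintro ⟨h, b⟩
      cases b with
      | true => simp [expect_step_true]
      | false =>
        rw [expect_step_false]
        calc _ ≤ expect (A h)
                (fun o => ((v (received h) - U : ℝ≥0) : ℝ≥0∞) + c * choicePrice o) := by
              refine expect_mono_of_support _ fun o ho => ?_
              cases o with
              | none => simp [afterChoice]
              | some l =>
                calc _ ≤ expect l.alloc (fun T => ((v (received h) - U : ℝ≥0) : ℝ≥0∞)
                        + ((v T - U : ℝ≥0) : ℝ≥0∞)) := by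
                      refine expect_mono _ fun T => ?_
                      simp only [← ENNReal.coe_add, received_cons, Finset.union_comm T]
                      exact ENNReal.coe_le_coe.2 (hv.union_tsub_le _ _ _)
                  _ ≤ _ := by
                      rw [expect_add, expect_const]
                      exact add_le_add le_rfl (hL l (hA h l ho))
          _ = _ := by rw [expect_add, expect_const, expect_const_mul]; rfl
    rw [expect_run_succ, expect_run_succ]
    simp only [expect_step_paid]
    calc _ ≤ _ := expect_mono _ key
      _ ≤ _ := by
        rw [expect_add, expect_add, expect_const_mul, mul_add]
        exact add_le_add ih le_rfl

theorem value_le_of_excess {L : Set (Lottery n)} {v : ValuationFn n} (hv : IsUnitDemand v)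
    {U : ℝ≥0} {c : ℝ≥0∞}
    (hL : ∀ l ∈ L, expect l.alloc (fun T => ((v T - U : ℝ≥0) : ℝ≥0∞)) ≤ c * l.price)
    {A : Strategy n} (hA : A.BuysFrom L) : A.value v ≤ U + c * A.payment := by
  rw [value_eq]
  refine iSup_le fun k => ?_
  calc _ ≤ expect (A.run k) (fun s => (U : ℝ≥0∞) + ((v (received s.1) - U : ℝ≥0) : ℝ≥0∞)) := by
        refine expect_mono _ fun s => ?_
        rw [← ENNReal.coe_add]
        exact ENNReal.coe_le_coe.2 le_add_tsub
    _ ≤ _ := by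
        rw [expect_add, expect_const]
        refine add_le_add le_rfl ((expect_run_excess_le hv hL hA k).trans ?_)
        gcongr
        exact le_iSup (fun k => expect (A.run k) fun s => (paid s.1 : ℝ≥0∞)) k

theorem utility_le_iff (A : Strategy n) (v : ValuationFn n) (U : ℝ≥0) :
    A.utility v ≤ ((U : ℝ≥0∞) : EReal) ↔ A.value v ≤ U + A.payment := by
  unfold utility
  by_cases hp : A.payment = ⊤
  · simp [hp]
  · rw [EReal.sub_le_iff_le_add (Or.inl (EReal.coe_ennreal_ne_bot _))
      (Or.inl (by simpa using hp)), ← EReal.coe_ennreal_add, EReal.coe_ennreal_le_coe_ennreal_iff]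

theorem value_ne_top (A : Strategy n) {v : ValuationFn n} (hv : IsUnitDemand v) :
    A.value v ≠ ⊤ := by
  refine ne_top_of_le_ne_top (b := (v Finset.univ : ℝ≥0∞)) ENNReal.coe_ne_top ?_
  rw [value_eq]
  refine iSup_le fun k => ?_
  rw [← expect_const (A.run k) (v Finset.univ : ℝ≥0∞)]
  exact expect_mono _ fun s => ENNReal.coe_le_coe.2 (hv.mono (Finset.subset_univ _))

/-- The strategy that buys nothing. -/
noncomputable def buyNothing : Strategy n := fun _ => PMF.pure none

theorem buyNothing_buysFrom (L : Set (Lottery n)) : (buyNothing : Strategy n).BuysFrom L := by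
  intro h l hl
  simp [buyNothing] at hl

theorem buyNothing_payment : (buyNothing : Strategy n).payment = 0 := by
  have h : ∀ k, expect ((buyNothing : Strategy n).run k) (fun s => (paid s.1 : ℝ≥0∞)) = 0 := by
    intro k
    induction k with
    | zero => simp [expect_run_zero]
    | succ k ih =>
      rw [expect_run_succ]
      simp only [expect_step_paid]
      rw [expect_add, ih, zero_add]
      have : (buyNothing : Strategy n).nextPrice = fun _ => 0 := by
        funext s
        obtain ⟨h, b⟩ := s
        cases b
        · simp [nextPrice, buyNothing, expect_pure, choicePrice]
        · rfl
      rw [this, expect_const]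
  rw [payment_eq]
  simp [h]

theorem utility_buyNothing_nonneg (v : ValuationFn n) : 0 ≤ (buyNothing : Strategy n).utility v := by
  unfold utility
  rw [buyNothing_payment]
  simpa using EReal.coe_ennreal_nonneg _

theorem exists_utility_eq {A : Strategy n} {v : ValuationFn n} (hv : IsUnitDemand v)
    (h : 0 ≤ A.utility v) :
    A.payment ≠ ⊤ ∧ ∃ U : ℝ≥0, A.value v = U + A.payment ∧ A.utility v = ((U : ℝ≥0∞) : EReal) := by
  have hp : A.payment ≠ ⊤ := by
    intro hp
    simp [utility, hp] at h
  have hvt := A.value_ne_top hv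
  have hle : A.payment ≤ A.value v :=
    EReal.coe_ennreal_le_coe_ennreal_iff.1
      ((EReal.sub_nonneg (Or.inr (by simpa using hp)) (Or.inr (EReal.coe_ennreal_ne_bot _))).1 h)
  have hU : A.value v = (A.value v - A.payment).toNNReal + A.payment := by
    rw [ENNReal.coe_toNNReal (ENNReal.sub_ne_top hvt), tsub_add_cancel_of_le hle]
  refine ⟨hp, _, hU, le_antisymm ((utility_le_iff _ _ _).2 hU.le) ?_⟩
  rw [utility, EReal.le_sub_iff_add_le (Or.inl (EReal.coe_ennreal_ne_bot _))
    (Or.inl (by simpa using hp)), ← EReal.coe_ennreal_add, EReal.coe_ennreal_le_coe_ennreal_iff]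
  exact hU.ge

theorem IsOptimal.exists_utility {L : Set (Lottery n)} {v : ValuationFn n} (hv : IsUnitDemand v)
    {A : Strategy n} (hA : A.IsOptimal L v) :
    A.payment ≠ ⊤ ∧ ∃ U : ℝ≥0, A.value v = U + A.payment ∧
      ∀ B : Strategy n, B.BuysFrom L → B.value v ≤ U + B.payment := by
  obtain ⟨hp, U, hU, hAU⟩ :=
    exists_utility_eq hv ((utility_buyNothing_nonneg v).trans (hA.2 _ (buyNothing_buysFrom L)))
  exact ⟨hp, U, hU, fun B hB => (utility_le_iff _ _ _).1 (hAU ▸ hA.2 B hB)⟩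

/-! ### Repeating one lottery until success -/

/-- Buy the lottery `l` until it allocates a set from `G`. -/
noncomputable def buyUntil (l : Lottery n) (G : Finset (Finset (Fin n))) : Strategy n
  | [] => PMF.pure (some l)
  | e :: _ => if e.2 ∈ G then PMF.pure none else PMF.pure (some l)

theorem buyUntil_buysFrom {L : Set (Lottery n)} {l : Lottery n} (hl : l ∈ L)
    (G : Finset (Finset (Fin n))) : (buyUntil l G).BuysFrom L := by
  intro h m hm
  cases h with
  | nil =>
    simp only [buyUntil, PMF.support_pure, Set.mem_singleton_iff, Option.some.injEq] at hm
    exact hm ▸ hl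
  | cons e h =>
    by_cases he : e.2 ∈ G
    · simp [buyUntil, he] at hm
    · simp only [buyUntil, he, if_false, PMF.support_pure, Set.mem_singleton_iff,
        Option.some.injEq] at hm
      exact hm ▸ hl

/-- A function of the last allocated set, for states in which it belongs to `G`. -/
noncomputable def lastIn (G : Finset (Finset (Fin n))) (f : Finset (Fin n) → ℝ≥0∞) :
    History n × Bool → ℝ≥0∞
  | ([], _) => 0
  | (e :: _, _) => if e.2 ∈ G then f e.2 else 0

/-- The indicator of the states in which `buyUntil l G` goes on to buy. -/
noncomputable def active (G : Finset (Finset (Fin n))) : History n × Bool → ℝ≥0∞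
  | (_, true) => 0
  | ([], false) => 1
  | (e :: _, false) => if e.2 ∈ G then 0 else 1

theorem buyUntil_step_active (l : Lottery n) (G : Finset (Finset (Fin n)))
    (s : History n × Bool) :
    expect ((buyUntil l G).step s) (active G)
      = expect l.alloc (fun T => if T ∈ G then 0 else 1) * active G s := by
  obtain ⟨h, b⟩ := s
  cases b with
  | true => simp [expect_step_true, active]
  | false =>
    rw [expect_step_false]
    cases h with
    | nil => simp [buyUntil, expect_pure, afterChoice, active]
    | cons e h =>
      by_cases he : e.2 ∈ G <;> simp [buyUntil, he, expect_pure, afterChoice, active]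

theorem buyUntil_nextPrice (l : Lottery n) (G : Finset (Finset (Fin n)))
    (s : History n × Bool) :
    (buyUntil l G).nextPrice s = l.price * active G s := by
  obtain ⟨h, b⟩ := s
  cases b with
  | true => simp [nextPrice, active]
  | false =>
    cases h with
    | nil => simp [buyUntil, nextPrice, expect_pure, choicePrice, active]
    | cons e h =>
      by_cases he : e.2 ∈ G <;> simp [buyUntil, nextPrice, he, expect_pure, choicePrice, active]

theorem buyUntil_step_lastIn (l : Lottery n) (G : Finset (Finset (Fin n)))
    (f : Finset (Fin n) → ℝ≥0∞) (s : History n × Bool) :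
    lastIn G f s + expect l.alloc (fun T => if T ∈ G then f T else 0) * active G s
      ≤ expect ((buyUntil l G).step s) (lastIn G f) := by
  obtain ⟨h, b⟩ := s
  cases b with
  | true => simp [expect_step_true, active]
  | false =>
    rw [expect_step_false]
    cases h with
    | nil => simp [buyUntil, expect_pure, afterChoice, active, lastIn]
    | cons e h =>
      by_cases he : e.2 ∈ G <;> simp [buyUntil, he, expect_pure, afterChoice, active, lastIn]

theorem buyUntil_expect_active (l : Lottery n) (G : Finset (Finset (Fin n))) (k : ℕ) :
    expect ((buyUntil l G).run k) (active G)
      = expect l.alloc (fun T => if T ∈ G then 0 else 1) ^ k := by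
  induction k with
  | zero => simp [expect_run_zero, active]
  | succ k ih =>
    rw [expect_run_succ]
    simp only [buyUntil_step_active]
    rw [expect_const_mul, ih, pow_succ']

/-- The strategy is still buying after `k` rounds with probability `r ^ k`, where `r` is the chance
that one draw misses `G`; hence the geometric series. -/
theorem buyUntil_payment (l : Lottery n) (G : Finset (Finset (Fin n))) :
    (buyUntil l G).payment
      = l.price * ∑' k, expect l.alloc (fun T => if T ∈ G then 0 else 1) ^ k := by
  have h : ∀ k, expect ((buyUntil l G).run k) (fun s => (paid s.1 : ℝ≥0∞))
      = l.price * ∑ j ∈ Finset.range k,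
          expect l.alloc (fun T => if T ∈ G then 0 else 1) ^ j := by
    intro k
    induction k with
    | zero => simp [expect_run_zero]
    | succ k ih =>
      rw [expect_run_succ]
      simp only [expect_step_paid, buyUntil_nextPrice]
      rw [expect_add, expect_const_mul, ih, buyUntil_expect_active, Finset.sum_range_succ, mul_add]
  rw [payment_eq, ENNReal.tsum_eq_iSup_nat, ENNReal.mul_iSup]
  simp only [h]

theorem le_buyUntil_value {v : ValuationFn n} (hv : IsUnitDemand v) (l : Lottery n)
    (G : Finset (Finset (Fin n))) :
    expect l.alloc (fun T => if T ∈ G then (v T : ℝ≥0∞) else 0)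
        * ∑' k, expect l.alloc (fun T => if T ∈ G then 0 else 1) ^ k
      ≤ (buyUntil l G).value v := by
  have h : ∀ k, expect l.alloc (fun T => if T ∈ G then (v T : ℝ≥0∞) else 0)
      * ∑ j ∈ Finset.range k, expect l.alloc (fun T => if T ∈ G then 0 else 1) ^ j
      ≤ expect ((buyUntil l G).run k) (lastIn G fun T => v T) := by
    intro k
    induction k with
    | zero => simp
    | succ k ih =>
      rw [expect_run_succ]
      refine le_trans ?_ (expect_mono _ fun s => buyUntil_step_lastIn l G _ s)
      rw [expect_add, expect_const_mul, buyUntil_expect_active, Finset.sum_range_succ, mul_add]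
      exact add_le_add ih le_rfl
  rw [value_eq, ENNReal.tsum_eq_iSup_nat, ENNReal.mul_iSup]
  refine iSup_mono fun k => (h k).trans (expect_mono _ ?_)
  rintro ⟨h, b⟩
  cases h with
  | nil => simp [lastIn]
  | cons e h =>
    by_cases he : e.2 ∈ G
    · simp only [lastIn, he, if_true, received_cons]
      exact ENNReal.coe_le_coe.2 (hv.mono Finset.subset_union_left)
    · simp [lastIn, he]

/-- The sets worth more than `U`. -/
noncomputable def setsAbove (v : ValuationFn n) (U : ℝ≥0) : Finset (Finset (Fin n)) :=
  Finset.univ.filter fun T => U < v T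

/-- If buying `l` until it allocates a set worth more than `U` has utility at most `U`, then the
expected excess of `l` over `U` is at most its price. -/
theorem excess_le_price {v : ValuationFn n} (hv : IsUnitDemand v) {l : Lottery n} {U : ℝ≥0}
    (h : (buyUntil l (setsAbove v U)).value v ≤ U + (buyUntil l (setsAbove v U)).payment) :
    expect l.alloc (fun T => ((v T - U : ℝ≥0) : ℝ≥0∞)) ≤ l.price := by
  set G := setsAbove v U with hG
  have hmem : ∀ T, T ∈ G ↔ U < v T := fun T => by simp [hG, setsAbove]
  set r := expect l.alloc (fun T => if T ∈ G then (0 : ℝ≥0∞) else 1) with hr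
  set g := expect l.alloc (fun T => if T ∈ G then (1 : ℝ≥0∞) else 0) with hg
  set m := expect l.alloc (fun T => ((v T - U : ℝ≥0) : ℝ≥0∞)) with hm
  have hgr : g + r = 1 := by
    rw [hg, hr, ← expect_add]
    refine Eq.trans ?_ (expect_const l.alloc 1)
    congr 1; funext T; by_cases hT : T ∈ G <;> simp [hT]
  have hsplit : expect l.alloc (fun T => if T ∈ G then (v T : ℝ≥0∞) else 0) = m + U * g := by
    rw [hm, hg, ← expect_const_mul, ← expect_add]
    congr 1; funext T
    by_cases hT : T ∈ G
    · simp only [hT, if_true, mul_one]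
      rw [← ENNReal.coe_add, tsub_add_cancel_of_le ((hmem T).1 hT).le]
    · have : v T - U = 0 := tsub_eq_zero_of_le (not_lt.1 fun h => hT ((hmem T).2 h))
      simp [hT, this]
  have hg1 : g ≠ ⊤ := ne_top_of_le_ne_top ENNReal.one_ne_top (hgr ▸ le_self_add)
  have hr1 : r ≠ ⊤ := ne_top_of_le_ne_top ENNReal.one_ne_top (hgr ▸ le_add_self)
  -- If success has probability zero the strategy never stops and its cost says nothing, but then
  -- the excess vanishes almost surely.
  by_cases hg0 : g = 0
  · have : m ≤ ⊤ * g := by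
      rw [hg, hm, ← expect_const_mul]
      refine expect_mono _ fun T => ?_
      by_cases hT : T ∈ G
      · simp [hT]
      · simp [tsub_eq_zero_of_le (not_lt.1 fun h => hT ((hmem T).2 h))]
    simp only [hg0, mul_zero] at this
    exact this.trans zero_le
  -- The expected number of purchases is `1 / g`, so the hypothesis reads `(m + U * g) / g ≤ U +
  -- price / g`; multiply by `g`.
  · have h1 := (le_buyUntil_value hv l G).trans h
    rw [buyUntil_payment, ← hr, ENNReal.tsum_geometric, hsplit] at h1
    have h2 : (1 : ℝ≥0∞) - r = g := by
      rw [← hgr]; exact ENNReal.add_sub_cancel_right hr1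
    rw [h2] at h1
    have h3 := mul_le_mul_left h1 g
    rw [mul_assoc, ENNReal.inv_mul_cancel hg0 hg1, mul_one, add_mul, mul_assoc,
      ENNReal.inv_mul_cancel hg0 hg1, mul_one, add_comm] at h3
    exact (ENNReal.add_le_add_iff_left (ENNReal.mul_ne_top ENNReal.coe_ne_top hg1)).1 h3

/-- It suffices to maximise over finitely many strategies: if `U` is the best utility among buying
nothing and repeating one lottery, each lottery has excess over `U` at most its price, so no
adaptive strategy beats `U`. -/
theorem exists_isOptimal {v : ValuationFn n} (hv : IsUnitDemand v) (M : Finset (Lottery n)) :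
    ∃ A : Strategy n, A.IsOptimal (M : Set (Lottery n)) v := by
  classical
  -- All stopping families are included because the relevant one, `setsAbove v U`, depends on the
  -- maximum `U` still to be found.
  let F : Finset (Strategy n) := insert buyNothing
    ((M ×ˢ (Finset.univ : Finset (Finset (Finset (Fin n))))).image fun x => buyUntil x.1 x.2)
  obtain ⟨A, hAF, hA⟩ := F.exists_max_image (fun A => A.utility v) ⟨buyNothing, Finset.mem_insert_self _ _⟩
  have hAM : A.BuysFrom (M : Set (Lottery n)) := by
    rcases Finset.mem_insert.1 hAF with rfl | h
    · exact buyNothing_buysFrom _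
    · obtain ⟨x, hx, rfl⟩ := Finset.mem_image.1 h
      exact buyUntil_buysFrom (Finset.mem_product.1 hx).1 _
  obtain ⟨-, U, -, hU⟩ :=
    exists_utility_eq hv ((utility_buyNothing_nonneg v).trans (hA _ (Finset.mem_insert_self _ _)))
  refine ⟨A, hAM, fun B hB => ?_⟩
  rw [hU, utility_le_iff, ← one_mul B.payment]
  refine value_le_of_excess hv (fun l hl => ?_) hB
  rw [one_mul]
  refine excess_le_price hv ?_
  rw [← utility_le_iff, ← hU]
  exact hA _ (Finset.mem_insert_of_mem (Finset.mem_image.2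
    ⟨(l, _), Finset.mem_product.2 ⟨hl, Finset.mem_univ _⟩, rfl⟩))

end Strategy

/-! ### Polar sets and finite nets -/

/-- The vectors `ξ` with `∑ i, ξ i * d i ≤ 1` for all `d ∈ W`. -/
def polar {n : ℕ} (W : Set (Fin n → ℝ≥0)) : Set (Fin n → ℝ≥0) :=
  {ξ | ∀ d ∈ W, ∑ i, ξ i * d i ≤ 1}

theorem mul_le_one_of_mem_polar {n : ℕ} {W : Set (Fin n → ℝ≥0)} {ξ : Fin n → ℝ≥0}
    (hξ : ξ ∈ polar W) {d : Fin n → ℝ≥0} (hd : d ∈ W) (j : Fin n) : ξ j * d j ≤ 1 :=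
  (Finset.single_le_sum (f := fun i => ξ i * d i) (fun _ _ => zero_le)
    (Finset.mem_univ j)).trans (hξ d hd)

theorem eq_zero_of_not_bddAbove {n : ℕ} {W : Set (Fin n → ℝ≥0)} {ξ : Fin n → ℝ≥0}
    (hξ : ξ ∈ polar W) {j : Fin n} (hj : ¬ BddAbove ((fun d => d j) '' W)) : ξ j = 0 := by
  by_contra h0
  refine hj ⟨(ξ j)⁻¹, ?_⟩
  rintro _ ⟨d, hd, rfl⟩
  rw [← mul_le_mul_iff_right₀ (pos_iff_ne_zero.2 h0), mul_inv_cancel₀ h0]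
  exact mul_le_one_of_mem_polar hξ hd j

/-- Normalises the polar into the unit cube. Unbounded coordinates are harmless: there `ξ j = 0` by
`eq_zero_of_not_bddAbove`. -/
theorem mul_sSup_le_one {n : ℕ} {W : Set (Fin n → ℝ≥0)} {ξ : Fin n → ℝ≥0}
    (hξ : ξ ∈ polar W) (j : Fin n) : ξ j * sSup ((fun d => d j) '' W) ≤ 1 := by
  by_cases h0 : ξ j = 0
  · simp [h0]
  · rw [← mul_inv_cancel₀ h0]
    refine mul_le_mul_right ?_ _
    refine csSup_le' ?_
    rintro _ ⟨d, hd, rfl⟩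
    rw [← mul_le_mul_iff_right₀ (pos_iff_ne_zero.2 h0), mul_inv_cancel₀ h0]
    exact mul_le_one_of_mem_polar hξ hd j

/-- Finitely many linear inequalities valid on `W` imply, up to a factor `1 + n / N`, all those
with right-hand side `1`; this remains so for vectors satisfying the former with all
right-hand sides scaled by some `a`. -/
theorem exists_finite_net {n : ℕ} (N : ℕ) (hN : 0 < N) (W : Set (Fin n → ℝ≥0)) :
    ∃ M : Finset ((Fin n → ℝ≥0) × ℝ≥0), M.card ≤ (N + 1) ^ n + n ∧
      (∀ y ∈ M, ∀ d ∈ W, ∑ i, y.1 i * d i ≤ y.2) ∧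
      ∀ ξ ∈ polar W, ∀ (d : Fin n → ℝ≥0) (a : ℝ≥0),
        (∀ y ∈ M, ∑ i, y.1 i * d i ≤ a * y.2) → ∑ i, ξ i * d i ≤ a * (1 + n / N) := by
  classical
  let q : Fin n → ℝ≥0 := fun j => sSup ((fun d => d j) '' W)
  -- Grid of mesh `1 / N` after normalisation. The floor is at most `N` on the polar, so `Fin.ofNat`
  -- does not wrap around there.
  let cell : (Fin n → ℝ≥0) → (Fin n → Fin (N + 1)) := fun ξ j =>
    Fin.ofNat (N + 1) ⌊ξ j * q j * N⌋₊
  -- A representative for each cell; empty cells get `0`, which always lies in the polar.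
  have hrep : ∀ g : Fin n → Fin (N + 1), ∃ ξ ∈ polar W, (∃ η ∈ polar W, cell η = g) → cell ξ = g := by
    intro g
    by_cases h : ∃ η ∈ polar W, cell η = g
    · obtain ⟨η, h1, h2⟩ := h
      exact ⟨η, h1, fun _ => h2⟩
    · exact ⟨0, fun d _ => by simp, fun h' => absurd h' h⟩
  choose rep hrepW hrepcell using hrep
  let B : Finset (Fin n) := Finset.univ.filter fun j => BddAbove ((fun d => d j) '' W)
  let M₁ : Finset ((Fin n → ℝ≥0) × ℝ≥0) := Finset.univ.image fun g => (rep g, 1)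
  -- The bounds `d j ≤ a * q j` are needed separately, since `d` need not lie in `W` and the
  -- rounding error is multiplied by `d j`.
  let M₂ : Finset ((Fin n → ℝ≥0) × ℝ≥0) := B.image fun j => (Pi.single j 1, q j)
  have hsingle : ∀ (j : Fin n) (d : Fin n → ℝ≥0),
      ∑ i, (Pi.single j 1 : Fin n → ℝ≥0) i * d i = d j := by
    intro j d
    rw [Finset.sum_eq_single j]
    · simp
    · intro i _ hi
      simp [Pi.single_eq_of_ne hi]
    · simp
  refine ⟨M₁ ∪ M₂, ?_, ?_, ?_⟩
  · refine (Finset.card_union_le _ _).trans (add_le_add ?_ ?_)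
    · refine Finset.card_image_le.trans ?_
      simp
    · refine Finset.card_image_le.trans ((Finset.card_le_univ _).trans ?_)
      simp
  · intro y hy d hd
    rcases Finset.mem_union.1 hy with h | h
    · obtain ⟨g, -, rfl⟩ := Finset.mem_image.1 h
      exact hrepW g d hd
    · obtain ⟨j, hj, rfl⟩ := Finset.mem_image.1 h
      simp only [hsingle]
      exact le_csSup (Finset.mem_filter.1 hj).2 ⟨d, hd, rfl⟩
  · intro ξ hξ d a hM
    set ξ' := rep (cell ξ) with hξ'
    have hW' : ξ' ∈ polar W := hrepW _
    have hcell : cell ξ' = cell ξ := hrepcell _ ⟨ξ, hξ, rfl⟩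
    have hclose : ∀ j, ξ j * q j - ξ' j * q j ≤ 1 / N := by
      intro j
      have h1 := congrArg Fin.val (congrFun hcell j)
      have hb : ∀ η ∈ polar W, ⌊η j * q j * N⌋₊ < N + 1 := by
        intro η hη
        rw [Nat.lt_succ_iff]
        refine Nat.floor_le_of_le ?_
        calc η j * q j * N ≤ 1 * N := mul_le_mul_left (mul_sSup_le_one hη j) _
          _ = N := one_mul _
      simp only [cell, Fin.val_ofNat, Nat.mod_eq_of_lt (hb _ hξ), Nat.mod_eq_of_lt (hb _ hW')] at h1
      have hNpos : (0 : ℝ≥0) < N := by exact_mod_cast hN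
      rw [tsub_le_iff_left, ← mul_le_mul_iff_left₀ hNpos, add_mul, one_div,
        inv_mul_cancel₀ hNpos.ne']
      calc ξ j * q j * N ≤ ⌊ξ j * q j * N⌋₊ + 1 := (Nat.lt_floor_add_one _).le
        _ = ⌊ξ' j * q j * N⌋₊ + 1 := by rw [h1]
        _ ≤ _ := add_le_add (Nat.floor_le zero_le) le_rfl
    have hterm : ∀ j, ξ j * d j ≤ ξ' j * d j + a * (1 / N) := by
      intro j
      by_cases hj : BddAbove ((fun d => d j) '' W)
      · have hdj : d j ≤ a * q j := by
          have := hM (Pi.single j 1, q j) (Finset.mem_union_right _ (Finset.mem_image_of_mem _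
            (Finset.mem_filter.2 ⟨Finset.mem_univ _, hj⟩)))
          simpa only [hsingle] using this
        calc ξ j * d j ≤ (ξ' j + (ξ j - ξ' j)) * d j := mul_le_mul_left le_add_tsub _
          _ = ξ' j * d j + (ξ j - ξ' j) * d j := add_mul _ _ _
          _ ≤ ξ' j * d j + (ξ j - ξ' j) * (a * q j) :=
            add_le_add le_rfl (mul_le_mul_right hdj _)
          _ = ξ' j * d j + a * (ξ j * q j - ξ' j * q j) := by rw [← tsub_mul]; ring
          _ ≤ _ := add_le_add le_rfl (mul_le_mul_right (hclose j) _)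
      · simp [eq_zero_of_not_bddAbove hξ hj]
    calc ∑ i, ξ i * d i ≤ ∑ i, (ξ' i * d i + a * (1 / N)) := Finset.sum_le_sum fun j _ => hterm j
      _ = ∑ i, ξ' i * d i + n * (a * (1 / N)) := by
        rw [Finset.sum_add_distrib]; simp
      _ ≤ a * 1 + n * (a * (1 / N)) :=
        add_le_add (hM (ξ', 1) (Finset.mem_union_left _
          (Finset.mem_image_of_mem _ (Finset.mem_univ _)))) le_rfl
      _ = _ := by ring

/-! ### Single-item lotteries -/

section Single
variable {n : ℕ}

/-- The law of a single random item proportional to `y`, or no item. -/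
noncomputable def singleAlloc (y : Fin n → ℝ≥0) : PMF (Finset (Fin n)) :=
  (PMF.ofFintype (fun o : Option (Fin n) => ((o.elim 1 y / (1 + ∑ i, y i) : ℝ≥0) : ℝ≥0∞)) (by
    have h : (1 + ∑ i, y i : ℝ≥0) ≠ 0 := by positivity
    rw [Fintype.sum_option, ← ENNReal.ofNNReal_finsetSum, ← ENNReal.coe_add, ENNReal.coe_eq_one]
    simp only [Option.elim, ← Finset.sum_div, ← add_div]
    exact div_self h)).map fun o => o.elim ∅ fun i => {i}

theorem expect_singleAlloc (y : Fin n → ℝ≥0) (f : Finset (Fin n) → ℝ≥0) (hf : f ∅ = 0) :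
    expect (singleAlloc y) (fun T => (f T : ℝ≥0∞))
      = (((∑ i, y i * f {i}) / (1 + ∑ i, y i) : ℝ≥0) : ℝ≥0∞) := by
  rw [singleAlloc, expect_map, expect, tsum_fintype, Fintype.sum_option]
  simp only [PMF.ofFintype_apply, Option.elim, hf, ENNReal.coe_zero, mul_zero, zero_add,
    ← ENNReal.coe_mul, ← ENNReal.ofNNReal_finsetSum, Finset.sum_div]
  congr 1
  exact Finset.sum_congr rfl fun i _ => by ring

/-- The lottery allocating a single item proportionally to `y`, at the price `p` in the same
proportion. -/
noncomputable def singleLottery (y : Fin n → ℝ≥0) (p : ℝ≥0) : Lottery n where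
  alloc := singleAlloc y
  price := p / (1 + ∑ i, y i)

theorem expect_singleLottery_le_iff {v : ValuationFn n} (hv : IsUnitDemand v) (U c : ℝ≥0)
    (y : Fin n → ℝ≥0) (p : ℝ≥0) :
    expect (singleLottery y p).alloc (fun T => ((v T - U : ℝ≥0) : ℝ≥0∞))
        ≤ c * (singleLottery y p).price ↔ ∑ i, y i * (v {i} - U) ≤ c * p := by
  have h : (0 : ℝ≥0) < 1 + ∑ i, y i := by positivity
  rw [show (singleLottery y p).alloc = singleAlloc y from rfl,
    expect_singleAlloc y (fun T => v T - U) (by simp [hv.empty]), ← ENNReal.coe_mul,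
    ENNReal.coe_le_coe, show (singleLottery y p).price = p / (1 + ∑ i, y i) from rfl,
    ← mul_div_assoc, div_le_div_iff_of_pos_right h]

end Single

/-! ### Item weights of a random set -/

section Choice
variable {n : ℕ}

/-- An item of the greatest value among those in `S`, given `S` is nonempty. -/
theorem IsUnitDemand.exists_choice {v : ValuationFn n} (hv : IsUnitDemand v) :
    ∃ c : Finset (Fin n) → Option (Fin n),
      (∀ S, v S = (c S).elim 0 fun i => v {i}) ∧ ∀ S i, c S = some i → i ∈ S := by
  have : ∀ S : Finset (Fin n), ∃ o : Option (Fin n),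
      (v S = o.elim 0 fun i => v {i}) ∧ ∀ i, o = some i → i ∈ S := by
    intro S
    rcases S.eq_empty_or_nonempty with rfl | hS
    · exact ⟨none, by simp [hv.empty], by simp⟩
    · obtain ⟨i, hi, h⟩ := hv.exists_mem_eq hS
      exact ⟨some i, by simpa using h, by rintro j ⟨⟩; exact hi⟩
  choose c h1 h2 using this
  exact ⟨c, h1, h2⟩

/-- Under a law of sets, choosing the best item according to `v` gives weights `x` on the items
which account for the excesses of `v` and bound below those of the other valuations. -/
theorem exists_item_weights {α : Type*} (μ : PMF α) (r : α → Finset (Fin n)) {v : ValuationFn n}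
    (hv : IsUnitDemand v) :
    ∃ x : Fin n → ℝ≥0,
      (∀ U : ℝ≥0, expect μ (fun s => ((v (r s) - U : ℝ≥0) : ℝ≥0∞))
        = ((∑ i, x i * (v {i} - U) : ℝ≥0) : ℝ≥0∞)) ∧
      ∀ (w : ValuationFn n) (U : ℝ≥0), IsUnitDemand w →
        ((∑ i, x i * (w {i} - U) : ℝ≥0) : ℝ≥0∞)
          ≤ expect μ (fun s => ((w (r s) - U : ℝ≥0) : ℝ≥0∞)) := by
  classical
  obtain ⟨c, hc, hcmem⟩ := hv.exists_choice
  have hx : ∀ i, expect μ (fun s => if c (r s) = some i then 1 else 0) ≠ ⊤ := by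
    intro i
    refine ne_top_of_le_ne_top ENNReal.one_ne_top ?_
    refine (expect_mono _ fun s => ?_).trans_eq (expect_const μ 1)
    by_cases h : c (r s) = some i <;> simp [h]
  have key : ∀ (w : ValuationFn n) (U : ℝ≥0),
      ((∑ i, (expect μ (fun s => if c (r s) = some i then 1 else 0)).toNNReal * (w {i} - U)
        : ℝ≥0) : ℝ≥0∞)
      = expect μ (fun s => (((c (r s)).elim 0 fun i => w {i} - U : ℝ≥0) : ℝ≥0∞)) := by
    intro w U
    have hi : ∀ i, (((expect μ (fun s => if c (r s) = some i then 1 else 0)).toNNReal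
        * (w {i} - U) : ℝ≥0) : ℝ≥0∞) = expect μ (fun s => ((w {i} - U : ℝ≥0) : ℝ≥0∞)
          * if c (r s) = some i then 1 else 0) := by
      intro i
      rw [expect_const_mul, ENNReal.coe_mul, ENNReal.coe_toNNReal (hx i), mul_comm]
    rw [ENNReal.ofNNReal_finsetSum, Finset.sum_congr rfl fun i _ => hi i, ← expect_finset_sum]
    congr 1
    funext s
    cases c (r s) with
    | none => simp
    | some j => simp
  refine ⟨fun i => (expect μ (fun s => if c (r s) = some i then 1 else 0)).toNNReal,
    fun U => ?_, fun w U hw => ?_⟩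
  · rw [key]
    congr 1
    funext s
    rw [hc]
    cases c (r s) <;> simp
  · rw [key]
    refine expect_mono _ fun s => ENNReal.coe_le_coe.2 ?_
    rcases h : c (r s) with _ | i
    · simp
    · exact tsub_le_tsub_right (hw.mono (Finset.singleton_subset_iff.2 (hcmem _ _ h))) _

end Choice

/-! ### Comparing the two menus -/

/-- The excesses of the values of the single items over `U`, for all unit-demand types and all
upper bounds `U` of their utilities. -/
def excesses {n : ℕ} (L : Set (Lottery n)) : Set (Fin n → ℝ≥0) :=
  {d | ∃ (w : ValuationFn n) (U : ℝ≥0), IsUnitDemand w ∧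
    (∀ B : Strategy n, B.BuysFrom L → B.value w ≤ U + B.payment) ∧ d = fun i => w {i} - U}

theorem excess_le_price_of_mem {n : ℕ} {L : Set (Lottery n)} {w : ValuationFn n}
    (hw : IsUnitDemand w) {U : ℝ≥0}
    (hU : ∀ B : Strategy n, B.BuysFrom L → B.value w ≤ U + B.payment) {l : Lottery n}
    (hl : l ∈ L) : expect l.alloc (fun T => ((w T - U : ℝ≥0) : ℝ≥0∞)) ≤ 1 * l.price := by
  rw [one_mul]
  exact Strategy.excess_le_price hw (hU _ (Strategy.buyUntil_buysFrom hl _))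

/-- The first two bounds give `p(1 - a(1+e)) ≤ V - U ≤ pB(a⁻¹ - 1)`. The bound on `e` makes the left
factor at least `a(1 - a)`, the slack being at least `(1 - a)³`. -/
theorem payment_comparison {p pB U V a e : ℝ} (ha : 0 < a) (ha1 : a < 1)
    (h1 : U + p ≤ V + a * (1 + e) * p) (h2 : V + pB ≤ U + a⁻¹ * pB) (he : e ≤ (1 - a) ^ 2)
    (hp : 0 ≤ p) : a ^ 2 * p ≤ pB := by
  have h3 : p * (1 - a * (1 + e)) ≤ pB * (a⁻¹ - 1) := by linarith
  have h4 : p * (a * (1 - a * (1 + e))) ≤ pB * (1 - a) := by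
    have := mul_le_mul_of_nonneg_left h3 ha.le
    have e1 : a * (pB * (a⁻¹ - 1)) = pB * (1 - a) := by field_simp
    linarith
  have h5 : p * (a * (a * (1 - a))) ≤ p * (a * (1 - a * (1 + e))) := by
    refine mul_le_mul_of_nonneg_left (mul_le_mul_of_nonneg_left ?_ ha.le) hp
    nlinarith
  have h6 : (a ^ 2 * p) * (1 - a) ≤ pB * (1 - a) := by nlinarith
  exact le_of_mul_le_mul_right h6 (by linarith)

/-- Every buy-many mechanism can be replaced by a finite one in which each unit-demand type pays
almost as much. -/
theorem exists_finite_menu {n : ℕ} (L : Set (Lottery n)) {a : ℝ≥0} (ha : 0 < a) (ha1 : a < 1)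
    (N : ℕ) (hN : 0 < N) (hNa : (n : ℝ) / N ≤ (1 - a) ^ 2) :
    ∃ M : Finset (Lottery n), M.card ≤ (N + 1) ^ n + n ∧
      ∀ v : ValuationFn n, IsUnitDemand v →
        (a : ℝ≥0∞) ^ 2 * maxPayment L v ≤ minPayment (M : Set (Lottery n)) v := by
  classical
  obtain ⟨M₀, hcard, hvalid, hnet⟩ := exists_finite_net N hN (excesses L)
  refine ⟨M₀.image fun y => singleLottery y.1 (a * y.2), Finset.card_image_le.trans hcard,
    fun v hv => ?_⟩
  set M := M₀.image fun y => singleLottery y.1 (a * y.2) with hM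
  rw [minPayment, if_pos (Strategy.exists_isOptimal hv M), maxPayment]
  simp only [ENNReal.mul_iSup]
  refine iSup₂_le fun A hA => le_iInf₂ fun B hB => ?_
  obtain ⟨hpA, U, hU, hUL⟩ := hA.exists_utility hv
  obtain ⟨hpB', V, hV, hVM⟩ := hB.exists_utility hv
  obtain ⟨p, hp⟩ : ∃ p : ℝ≥0, (p : ℝ≥0∞) = A.payment := ⟨_, ENNReal.coe_toNNReal hpA⟩
  obtain ⟨pB, hpB⟩ : ∃ p : ℝ≥0, (p : ℝ≥0∞) = B.payment := ⟨_, ENNReal.coe_toNNReal hpB'⟩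
  -- The net inequalities hold for the excess of `v` over its old utility `U`, so at undiscounted
  -- prices the new menu offers no utility beyond `U`.
  have hBle : B.value v ≤ U + (a⁻¹ : ℝ≥0) * B.payment := by
    refine Strategy.value_le_of_excess hv (fun l hl => ?_) hB.1
    obtain ⟨y, hy, rfl⟩ := Finset.mem_image.1 hl
    rw [expect_singleLottery_le_iff hv, ← mul_assoc, inv_mul_cancel₀ ha.ne', one_mul]
    exact hvalid y hy _ ⟨v, U, hv, hUL, rfl⟩
  -- Conversely, the excess over the new utility `V` satisfies the net inequalities scaled by `a`,
  -- although it need not be an excess vector of `L`.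
  have hMV : ∀ y ∈ M₀, ∑ i, y.1 i * (v {i} - V) ≤ a * y.2 := by
    intro y hy
    rw [← one_mul (a * y.2), ← expect_singleLottery_le_iff hv, ENNReal.coe_one]
    exact excess_le_price_of_mem hv hVM (Finset.mem_image_of_mem _ hy)
  rcases eq_or_ne p 0 with rfl | hp0
  · simp [← hp]
  have hAle : A.value v ≤ ((V + a * (1 + n / N) * p : ℝ≥0) : ℝ≥0∞) := by
    rw [Strategy.value_eq]
    refine iSup_le fun k => ?_
    -- The value is a supremum over rounds, so weights are extracted after each finite number of
    -- rounds, with a bound independent of that number. The equality for `v` recovers its value; the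
    -- inequality for other types puts `p⁻¹ * x` in the polar.
    obtain ⟨x, hxv, hxw⟩ := exists_item_weights (A.run k) (fun s => received s.1) hv
    have hx : ∀ d ∈ excesses L, ∑ i, x i * d i ≤ p := by
      rintro _ ⟨w, U', hw, hU', rfl⟩
      rw [← ENNReal.coe_le_coe, hp]
      refine (hxw w U' hw).trans ((Strategy.expect_run_excess_le hw
        (fun l hl => excess_le_price_of_mem hw hU' hl) hA.1 k).trans ?_)
      rw [one_mul]
      exact le_iSup (fun k => expect (A.run k) fun s => (paid s.1 : ℝ≥0∞)) k
    have hx' := hnet (fun i => p⁻¹ * x i) (fun d hd => by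
      simp only [mul_assoc, ← Finset.mul_sum]
      rw [← inv_mul_cancel₀ hp0]
      exact mul_le_mul_right (hx d hd) _) _ a hMV
    simp only [mul_assoc, ← Finset.mul_sum] at hx'
    rw [inv_mul_le_iff₀ (pos_iff_ne_zero.2 hp0)] at hx'
    calc _ ≤ expect (A.run k)
          (fun s => (V : ℝ≥0∞) + ((v (received s.1) - V : ℝ≥0) : ℝ≥0∞)) := by
          refine expect_mono _ fun s => ?_
          rw [← ENNReal.coe_add]
          exact ENNReal.coe_le_coe.2 le_add_tsub
      _ = ((V + ∑ i, x i * (v {i} - V) : ℝ≥0) : ℝ≥0∞) := by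
          rw [expect_add, expect_const, hxv, ENNReal.coe_add]
      _ ≤ _ := ENNReal.coe_le_coe.2 (add_le_add le_rfl (hx'.trans_eq (by ring)))
  rw [hV, ← hpB, ← ENNReal.coe_mul, ← ENNReal.coe_add, ← ENNReal.coe_add,
    ENNReal.coe_le_coe] at hBle
  rw [hU, ← hp, ← ENNReal.coe_add, ENNReal.coe_le_coe] at hAle
  rw [← hp, ← hpB, ← ENNReal.coe_pow, ← ENNReal.coe_mul, ENNReal.coe_le_coe]
  have h1 : (U : ℝ) + p ≤ V + a * (1 + n / N) * p := by exact_mod_cast hAle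
  have h2 : (V : ℝ) + pB ≤ U + (a : ℝ)⁻¹ * pB := by exact_mod_cast hBle
  exact_mod_cast payment_comparison (by exact_mod_cast ha) (by exact_mod_cast ha1) h1 h2 hNa p.2

/-! ### Parameters and the main theorem -/

/-- With `t = 16n/ε² ≥ 16` one has `⌈t⌉ + 1 ≤ t²`, so `t ^ (6 * n)` generously bounds each of the
two summands; hence the constant `2`. -/
theorem card_bound {n : ℕ} (hn : 0 < n) {ε : ℝ} (h0 : 0 < ε) (h1 : ε < 1) :
    (((⌈16 * n / ε ^ 2⌉₊ + 1) ^ n + n : ℕ) : ℝ)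
      ≤ 2 * ((16 * (n : ℝ)) ^ (6 * n) / ε ^ (12 * n)) := by
  set t : ℝ := 16 * n / ε ^ 2 with ht
  have hn1 : (1 : ℝ) ≤ n := by exact_mod_cast hn
  have htn : 16 * (n : ℝ) ≤ t := by
    rw [ht, le_div_iff₀ (by positivity)]
    have : ε ^ 2 ≤ 1 := by nlinarith
    nlinarith
  have heq : (16 * (n : ℝ)) ^ (6 * n) / ε ^ (12 * n) = t ^ (6 * n) := by
    rw [ht, div_pow, ← pow_mul]; congr 2; ring
  have hceil : (⌈t⌉₊ : ℝ) + 1 ≤ t ^ 2 := by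
    have := Nat.ceil_lt_add_one (show 0 ≤ t by linarith)
    nlinarith
  have ht1 : (1 : ℝ) ≤ t := by linarith
  have ha : ((⌈t⌉₊ : ℝ) + 1) ^ n ≤ t ^ (6 * n) :=
    calc ((⌈t⌉₊ : ℝ) + 1) ^ n ≤ (t ^ 2) ^ n := pow_le_pow_left₀ (by positivity) hceil n
      _ = t ^ (2 * n) := by rw [pow_mul]
      _ ≤ _ := pow_le_pow_right₀ ht1 (by omega)
  have hb : (n : ℝ) ≤ t ^ (6 * n) :=
    calc (n : ℝ) ≤ t ^ 1 := by linarith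
      _ ≤ _ := pow_le_pow_right₀ ht1 (by omega)
  rw [heq]
  push_cast
  linarith

end BuyMany

theorem mainTheorem2 :
    ∃ C : ℝ, 0 < C ∧
      ∀ (n : ℕ) (ε : ℝ), 0 < ε →
      ∀ (D : Measure (BuyMany.ValuationFn n)) [IsProbabilityMeasure D],
        (∀ᵐ v ∂D, BuyMany.IsUnitDemand v) →
        BuyMany.buyManyRev D ≠ ⊤ →
        ∃ M : Finset (BuyMany.Lottery n),
          (M.card : ℝ) ≤ C * ((16 * (n : ℝ)) ^ (6 * n) / ε ^ (12 * n)) ∧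
          ENNReal.ofReal (1 - ε) * BuyMany.buyManyRev D ≤ BuyMany.minRev D (M : Set (BuyMany.Lottery n)) := by
  refine ⟨2, two_pos, fun n ε hε D _ hD hfin => ?_⟩
  by_cases hε1 : 1 ≤ ε
  · exact ⟨∅, by rw [Finset.card_empty, Nat.cast_zero]; positivity,
      by simp [ENNReal.ofReal_of_nonpos (sub_nonpos.2 hε1)]⟩
  by_cases hR : BuyMany.buyManyRev D = 0
  · exact ⟨∅, by rw [Finset.card_empty, Nat.cast_zero]; positivity, by simp [hR]⟩
  rw [not_le] at hε1
  -- Three factors `a` are lost, one in choosing a near-optimal `L` and two in passing to the finite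
  -- menu, and `(1 - ε/4)³ ≥ 1 - ε`. Then `n / N ≤ (1 - a)² = ε²/16` leads to `N = ⌈16n/ε²⌉`.
  obtain ⟨a, ha⟩ : ∃ a : ℝ≥0, (a : ℝ) = 1 - ε / 4 := ⟨⟨1 - ε / 4, by linarith⟩, rfl⟩
  have ha0 : 0 < a := by rw [← NNReal.coe_pos, ha]; linarith
  have ha1 : a < 1 := by rw [← NNReal.coe_lt_coe, ha, NNReal.coe_one]; linarith
  have hlt : (a : ℝ≥0∞) * BuyMany.buyManyRev D < BuyMany.buyManyRev D := by
    conv_rhs => rw [← one_mul (BuyMany.buyManyRev D)]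
    exact ENNReal.mul_lt_mul_left hR hfin (by exact_mod_cast ha1)
  obtain ⟨L, hL⟩ := lt_iSup_iff.1 hlt
  have hmain : ∀ N : ℕ, 0 < N → (n : ℝ) / N ≤ (1 - a) ^ 2 →
      ∃ M : Finset (BuyMany.Lottery n), M.card ≤ (N + 1) ^ n + n ∧
        ENNReal.ofReal (1 - ε) * BuyMany.buyManyRev D
          ≤ BuyMany.minRev D (M : Set (BuyMany.Lottery n)) := by
    intro N hN hNa
    obtain ⟨M, hcard, hpay⟩ := BuyMany.exists_finite_menu L ha0 ha1 N hN hNa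
    refine ⟨M, hcard, ?_⟩
    have hc : ENNReal.ofReal (1 - ε) ≤ (a : ℝ≥0∞) ^ 2 * a := by
      refine ENNReal.ofReal_le_of_le_toReal ?_
      simp only [ENNReal.toReal_mul, ENNReal.toReal_pow, ENNReal.coe_toReal, ha]
      nlinarith [sq_nonneg ε, mul_nonneg hε.le (sq_nonneg ε)]
    calc ENNReal.ofReal (1 - ε) * BuyMany.buyManyRev D
        ≤ (a : ℝ≥0∞) ^ 2 * a * BuyMany.buyManyRev D := mul_le_mul_left hc _
      _ ≤ (a : ℝ≥0∞) ^ 2 * BuyMany.maxRev D L := by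
        rw [mul_assoc]; exact mul_le_mul_right hL.le _
      _ = ∫⁻ v, (a : ℝ≥0∞) ^ 2 * BuyMany.maxPayment L v ∂D :=
        -- Finiteness of the constant suffices here, so measurability of the payment is not needed.
        (lintegral_const_mul' _ _ (by simp)).symm
      _ ≤ _ := lintegral_mono_ae (hD.mono fun v hv => hpay v hv)
  -- For `n = 0` the formula for `N` would give `0`, so `N = 1` is used; the cardinality bound is
  -- then `2`, as `0 ^ 0 = 1`.
  rcases Nat.eq_zero_or_pos n with rfl | hn
  · obtain ⟨M, hcard, hrev⟩ := hmain 1 one_pos (by simpa using sq_nonneg _)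
    refine ⟨M, ?_, hrev⟩
    have : (M.card : ℝ) ≤ 1 := by exact_mod_cast hcard
    simp only [mul_zero, pow_zero, div_one, mul_one]
    linarith
  · have hn' : (0 : ℝ) < n := by exact_mod_cast hn
    have ht : 0 < 16 * (n : ℝ) / ε ^ 2 := by positivity
    have hN : 0 < ⌈16 * (n : ℝ) / ε ^ 2⌉₊ := Nat.ceil_pos.2 ht
    obtain ⟨M, hcard, hrev⟩ := hmain _ hN (by
      rw [div_le_iff₀ (by exact_mod_cast hN), ha]
      calc (n : ℝ) = (1 - (1 - ε / 4)) ^ 2 * (16 * (n : ℝ) / ε ^ 2) := by field_simp; ring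
        _ ≤ _ := mul_le_mul_of_nonneg_left (Nat.le_ceil _) (sq_nonneg _))
    exact ⟨M, (Nat.cast_le.2 hcard).trans (BuyMany.card_bound hn hε hε1), hrev⟩
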